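/- For $k\in\mathbb{N}$ let $\mathbb{M}_k$ be the algebra of complex $k\times k$ matrices, $\mathbb{M}_k^+$ the set of positive semidefinite ones, $I_k$ the identity matrix, and let $X\le Y$ mean that $Y-X\in\mathbb{M}_k^+$. A linear map $\Phi:\mathbb{M}_n\to\mathbb{M}_l$ is called positive if $\Phi(\mathbb{M}_n^+)\subseteq\mathbb{M}_l^+$. Let $\mathrm{OM}_{+,1}$ be the set of functions $f:[0,\infty)\to[0,\infty)$ with $f(1)=1$ that are operator monotone, i.e. $f(X)\le f(Y)$ (functional calculus) for all $k$ and all $X,Y\in\mathbb{M}_k$ with $0\le X\le Y$. For $f\in\mathrm{OM}_{+,1}$ define $f^*$ on $[0,\infty)$ by $f^*(x):=f(x^{-1})^{-1}$ for $x>0$ and $f^*(0):=\lim_{x\searrow0}f(x^{-1})^{-1}$. **Corollary 2.3.** Let $\Phi:\mathbb{M}_n\to\mathbb{M}_l$ and $\Psi:\mathbb{M}_m\to\mathbb{M}_l$ be positive linear maps such that $\Phi(I_n)^{1/2}\Psi(I_m)\Phi(I_n)^{1/2}\le I_l$. If $A\in\mathbb{M}_n^+$ and $B\in\mathbb{M}_m^+$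 satisfy $\Phi(A)^{1/2}\Psi(B)\Phi(A)^{1/2}\le I_l$, then $$\Phi(f^*(A))^{1/2}\,\Psi(f(B))\,\Phi(f^*(A))^{1/2}\le I_l\qquad\text{for every } f\in\mathrm{OM}_{+,1},$$ and in particular $$\Phi(A^\alpha)^{1/2}\,\Psi(B^\alpha)\,\Phi(A^\alpha)^{1/2}\le I_l\qquad\text{for } 0\le\alpha\le1,$$ where $X^0:=I$ for every $X\ge 0$. -/

import Mathlib

open scoped MatrixOrder ComplexOrder Topology

namespace MatrixMeans

/-- `f` is a member of `OM_{+,1}`: a non-negative operator monotone function on `[0,∞)` with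
`f 1 = 1`. Only the values of `f` on `[0,∞)` matter; `cfc f A` is the usual functional calculus
`f(A)` of a Hermitian matrix, and the order on matrices is the Loewner order. No continuity at `0`
is imposed. -/
structure OMPlusOne (f : ℝ → ℝ) : Prop where
  nonneg : ∀ x : ℝ, 0 ≤ x → 0 ≤ f x
  map_one : f 1 = 1
  operator_mono : ∀ (k : ℕ) (A B : Matrix (Fin k) (Fin k) ℂ),
    0 ≤ A → A ≤ B → cfc f A ≤ cfc f B

/-- The adjoint function `f*` of `f`: `f*(x) = f(x⁻¹)⁻¹` for `x > 0`, with the value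
`f*(0) = lim_{t → 0+} f(t⁻¹)⁻¹` at `0`. (Values at negative arguments are irrelevant.) -/
noncomputable def adjointFun (f : ℝ → ℝ) (x : ℝ) : ℝ :=
  if 0 < x then (f x⁻¹)⁻¹ else Filter.limUnder (𝓝[>] (0 : ℝ)) (fun t : ℝ => (f t⁻¹)⁻¹)

theorem OMPlusOne.monotoneOn {f : ℝ → ℝ} (hf : OMPlusOne f) : MonotoneOn f (Set.Ici 0) := by
  intro x hx y _ hxy
  have key := hf.operator_mono 1 (algebraMap ℝ _ x) (algebraMap ℝ _ y)
    (by
      rw [Matrix.nonneg_iff_posSemidef, Matrix.algebraMap_eq_diagonal]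
      exact Matrix.PosSemidef.diagonal (fun _ => by simpa using hx))
    (by
      rw [Matrix.le_iff, ← map_sub, Matrix.algebraMap_eq_diagonal]
      exact Matrix.PosSemidef.diagonal (fun _ => by simpa using hxy))
  rw [cfc_algebraMap, cfc_algebraMap, Matrix.le_iff, ← map_sub,
    Matrix.algebraMap_eq_diagonal, Matrix.posSemidef_diagonal_iff] at key
  simpa using key 0

/-- The limit in the definition of `f*(0)` exists. -/
theorem OMPlusOne.tendsto_adjointFun {f : ℝ → ℝ} (hf : OMPlusOne f) :
    Filter.Tendsto (adjointFun f) (𝓝[>] 0) (𝓝 (adjointFun f 0)) := by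
  have h0 : adjointFun f 0 = Filter.limUnder (𝓝[>] (0 : ℝ)) (fun t : ℝ => (f t⁻¹)⁻¹) := by
    simp [adjointFun]
  have heq : adjointFun f =ᶠ[𝓝[>] 0] fun t : ℝ => (f t⁻¹)⁻¹ := by
    filter_upwards [self_mem_nhdsWithin] with t ht
    exact if_pos ht
  rw [Filter.tendsto_congr' heq, h0]
  apply tendsto_nhds_limUnder
  have hone : ∀ t ∈ Set.Ioo (0 : ℝ) 1, 1 ≤ f t⁻¹ := fun t ht => by
    have := hf.monotoneOn (a := 1) (b := t⁻¹) (by simp) (by simpa using ht.1.le)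
      ((one_le_inv₀ ht.1).2 ht.2.le)
    rwa [hf.map_one] at this
  have hmono : MonotoneOn (fun t : ℝ => (f t⁻¹)⁻¹) (Set.Ioo 0 1) := fun s hs t ht hst =>
    inv_anti₀ (zero_lt_one.trans_le (hone t ht))
      (hf.monotoneOn (by simpa using ht.1.le) (by simpa using hs.1.le) (inv_anti₀ hs.1 hst))
  refine ⟨_, hmono.tendsto_nhdsWithin_Ioo_right (by simp) ⟨0, ?_⟩⟩
  rintro _ ⟨t, ht, rfl⟩
  exact inv_nonneg.2 (zero_le_one.trans (hone t ht))

end MatrixMeans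

/-! On the functional calculi of `A` and `B`, positive maps are compressions of diagonal matrices:
`Φ (g A) = Wᴴ g(D_a) W`, `Ψ (h B) = Vᴴ h(D_b) V` (`exists_map_cfc_eq`). As `M Mᴴ ≤ 1` iff `Mᴴ M ≤
1`, each condition becomes one on `K = V Wᴴ`: the hypotheses say that `K` is a contraction and, for
invertible `D_a`, that `Kᴴ D_b K ≤ D_a⁻¹`. Hansen's inequality and monotonicity then give `Kᴴ f(D_b)
K ≤ f(D_a⁻¹) = f*(D_a)⁻¹`, which is the claim. Since `D_a` may be singular and `f` may jump at `0`,
every step carries a slack `r > 1`; `map_mul_le` turns slack inside `f` into a factor outside, and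
finally `r → 1`. -/

namespace MatrixMeans

open Matrix

set_option linter.unusedSectionVars false

/-! ### Functional calculus by intertwiners, and Hansen's inequality -/

section
variable {ι κ : Type*} [Fintype ι] [DecidableEq ι] [Fintype κ] [DecidableEq κ]

/-- Simultaneous diagonalisation of all `cfc f A`, for a Hermitian matrix `A`. -/
theorem exists_unitary_cfc_eq {A : Matrix ι ι ℂ} (hA : A.IsHermitian) :
    ∃ (U : Matrix ι ι ℂ) (d : ι → ℝ), Uᴴ * U = 1 ∧ U * Uᴴ = 1 ∧ (∀ i, d i ∈ spectrum ℝ A) ∧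
      ∀ f : ℝ → ℝ, cfc f A = U * diagonal (fun i => (f (d i) : ℂ)) * Uᴴ := by
  refine ⟨hA.eigenvectorUnitary, hA.eigenvalues, ?_, ?_, hA.eigenvalues_mem_spectrum_real, ?_⟩
  · exact Unitary.coe_star_mul_self hA.eigenvectorUnitary
  · exact Unitary.coe_mul_star_self hA.eigenvectorUnitary
  · intro f
    rw [hA.cfc_eq, IsHermitian.cfc, Unitary.conjStarAlgAut_apply]
    rfl

theorem cfc_id_matrix {A : Matrix ι ι ℂ} (hA : A.IsHermitian) : cfc (fun x : ℝ => x) A = A :=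
  cfc_id' ℝ A hA

/-- An intertwiner of two Hermitian matrices intertwines their functional calculi. -/
theorem cfc_mul_eq_mul_cfc {X : Matrix ι ι ℂ} {Z : Matrix κ κ ℂ} (hX : X.IsHermitian)
    (hZ : Z.IsHermitian) {V : Matrix ι κ ℂ} (h : X * V = V * Z) (f : ℝ → ℝ) :
    cfc f X * V = V * cfc f Z := by
  obtain ⟨U, d, hU, hU', -, hf⟩ := exists_unitary_cfc_eq hX
  obtain ⟨T, e, hT, hT', -, hg⟩ := exists_unitary_cfc_eq hZ
  have key : ∀ g : ℝ → ℝ, cfc g X * V = V * cfc g Z ↔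
      diagonal (fun i => (g (d i) : ℂ)) * (Uᴴ * V * T) =
        (Uᴴ * V * T) * diagonal (fun i => (g (e i) : ℂ)) := by
    intro g
    rw [hf, hg]
    constructor
    · intro h
      calc _ = Uᴴ * U * diagonal (fun i => (g (d i) : ℂ)) * (Uᴴ * V * T) := by rw [hU, Matrix.one_mul]
        _ = Uᴴ * (U * diagonal (fun i => (g (d i) : ℂ)) * Uᴴ * V) * T := by
          simp only [Matrix.mul_assoc]
        _ = Uᴴ * V * T * diagonal (fun i => (g (e i) : ℂ)) * (Tᴴ * T) := by
          rw [h]; simp only [Matrix.mul_assoc]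
        _ = _ := by rw [hT, Matrix.mul_one]
    · intro h
      calc _ = U * (diagonal (fun i => (g (d i) : ℂ)) * (Uᴴ * V * T)) * Tᴴ := by
            simp only [Matrix.mul_assoc, hT', Matrix.mul_one]
        _ = (U * Uᴴ) * V * (T * diagonal (fun i => (g (e i) : ℂ)) * Tᴴ) := by
          rw [h]; simp only [Matrix.mul_assoc]
        _ = _ := by rw [hU', Matrix.one_mul]
  have h1 := (key fun x => x).1 (by rwa [cfc_id_matrix hX, cfc_id_matrix hZ])
  rw [key]
  ext i j
  have h2 := congrFun (congrFun h1 i) j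
  rw [diagonal_mul, mul_diagonal, mul_comm] at h2 ⊢
  -- In the eigenbases, a nonzero entry of the intertwiner forces the eigenvalues `d i` and `e j` to
  -- agree.
  by_cases h0 : (Uᴴ * V * T) i j = 0
  · simp [h0]
  · rw [Complex.ofReal_inj.1 (mul_left_cancel₀ h0 h2)]

theorem isHermitian_diagonal_ofReal (d : ι → ℝ) :
    (diagonal (fun i => (d i : ℂ))).IsHermitian :=
  isHermitian_diagonal_of_self_adjoint _ (by ext; simp)

/-- Each coordinate vector intertwines the diagonal matrix with a `1 × 1` scalar, so the columns can
be read off one by one. -/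
theorem cfc_diagonal_ofReal (f : ℝ → ℝ) (d : ι → ℝ) :
    cfc f (diagonal (fun i => (d i : ℂ))) = diagonal (fun i => (f (d i) : ℂ)) := by
  have h : ∀ i, cfc f (diagonal (fun i => (d i : ℂ))) *
        (Matrix.of fun k (_ : Unit) => if k = i then (1 : ℂ) else 0) =
      (Matrix.of fun k (_ : Unit) => if k = i then (1 : ℂ) else 0) *
        cfc f (algebraMap ℝ (Matrix Unit Unit ℂ) (d i)) := by
    intro i
    apply cfc_mul_eq_mul_cfc (isHermitian_diagonal_ofReal d)
    · exact IsSelfAdjoint.algebraMap _ (IsSelfAdjoint.all _)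
    · ext k u
      simp [Matrix.algebraMap_eq_diagonal, Matrix.mul_apply, diagonal_apply]
      grind
  ext k i
  have := congrFun (congrFun (h i) k) ()
  rw [cfc_algebraMap] at this
  simp only [Matrix.algebraMap_eq_diagonal, Matrix.mul_apply, of_apply, mul_ite, mul_one, mul_zero,
    Finset.sum_ite_eq', Finset.mem_univ, if_true, Finset.univ_unique, Finset.sum_singleton,
    ite_mul, one_mul, zero_mul, diagonal_apply] at this ⊢
  rw [this]
  split_ifs with h
  · subst h; simp
  · rfl

/-- Operator monotonicity for matrices indexed by an arbitrary finite type. -/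
theorem OMPlusOne.cfc_le_cfc {f : ℝ → ℝ} (hf : OMPlusOne f) {A B : Matrix ι ι ℂ} (hA : 0 ≤ A)
    (hAB : A ≤ B) : cfc f A ≤ cfc f B := by
  let e := Fintype.equivFin ι
  have hr : ∀ C : Matrix ι ι ℂ, C.IsHermitian → cfc f (C.submatrix e.symm e.symm) =
      (cfc f C).submatrix e.symm e.symm := by
    intro C hC
    -- The permutation matrix of `e` intertwines a matrix with its reindexing.
    have h1 : ∀ D : Matrix ι ι ℂ, D * (1 : Matrix ι ι ℂ).submatrix id e.symm =
        (1 : Matrix ι ι ℂ).submatrix id e.symm * D.submatrix e.symm e.symm := by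
      intro D
      ext i j
      rw [Matrix.mul_apply, Matrix.mul_apply, ← Equiv.sum_comp e]
      simp [one_apply]
    have h2 := cfc_mul_eq_mul_cfc hC (hC.submatrix e.symm) (h1 C) f
    rw [h1] at h2
    have h3 := congrArg (fun M => (1 : Matrix ι ι ℂ).submatrix e.symm id * M) h2
    have h4 : (1 : Matrix ι ι ℂ).submatrix e.symm id * (1 : Matrix ι ι ℂ).submatrix id e.symm =
        1 := by
      ext i j
      simp [Matrix.mul_apply, one_apply]
    simp only [← Matrix.mul_assoc, h4, Matrix.one_mul] at h3
    exact h3.symm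
  have hA' := nonneg_iff_posSemidef.1 hA
  have hB' := nonneg_iff_posSemidef.1 (hA.trans hAB)
  have := hf.operator_mono _ (A.submatrix e.symm e.symm) (B.submatrix e.symm e.symm)
    (nonneg_iff_posSemidef.2 (hA'.submatrix _)) (by
      rw [Matrix.le_iff] at hAB ⊢
      exact hAB.submatrix e.symm)
  rw [hr _ hA'.1, hr _ hB'.1, Matrix.le_iff] at this
  rw [Matrix.le_iff]
  exact (posSemidef_submatrix_equiv e.symm).1 this

theorem conjTranspose_mul_mul_mono {A B : Matrix ι ι ℂ} (h : A ≤ B) (V : Matrix ι κ ℂ) :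
    Vᴴ * A * V ≤ Vᴴ * B * V := by
  rw [Matrix.le_iff] at h ⊢
  simpa [Matrix.mul_sub, Matrix.sub_mul] using h.conjTranspose_mul_mul_same V

theorem conjTranspose_mul_mul_nonneg {A : Matrix ι ι ℂ} (h : 0 ≤ A) (V : Matrix ι κ ℂ) :
    0 ≤ Vᴴ * A * V := by
  simpa using conjTranspose_mul_mul_mono h V

theorem conjTranspose_mul_self_nonneg (V : Matrix ι κ ℂ) : 0 ≤ Vᴴ * V := by
  exact nonneg_iff_posSemidef.2 (posSemidef_conjTranspose_mul_self V)

/-- Hansen's inequality for isometries `V`, with a multiplicative slack `r > 1`. -/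
theorem conjTranspose_mul_mul_le_cfc_of_isometry {f : ℝ → ℝ} (hf : OMPlusOne f) {V : Matrix ι κ ℂ}
    (hV : Vᴴ * V = 1) {A : Matrix ι ι ℂ} (hA : 0 ≤ A) {Z : Matrix κ κ ℂ} {r : ℝ} (hr : 1 < r)
    (hZ : r • (Vᴴ * A * V) ≤ Z) : Vᴴ * cfc f A * V ≤ cfc f Z := by
  set R : Matrix ι ι ℂ := 1 - V * Vᴴ with hR
  have hRH : Rᴴ = R := by simp [hR]
  have hRV : R * V = 0 := by rw [hR, Matrix.sub_mul, Matrix.mul_assoc, hV]; simp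
  have hZ0 : 0 ≤ Z := (smul_nonneg (by linarith) (conjTranspose_mul_mul_nonneg hA V)).trans hZ
  -- With `P = V * Vᴴ`, expanding `(cP - c⁻¹R) A (cP - c⁻¹R) ≥ 0` bounds the off-diagonal blocks of
  -- `A` by `c² PAP + c⁻² RAR`; the slack `r - 1` pays for the first term, `s` for the second.
  obtain ⟨c, hc, hcr⟩ : ∃ c : ℝ, 0 < c ∧ c ^ 2 = r - 1 :=
    ⟨√(r - 1), Real.sqrt_pos.2 (by linarith), Real.sq_sqrt (by linarith)⟩
  set s : ℝ := 1 + c⁻¹ ^ 2 with hs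
  -- A block-diagonal majorant of `A`: `V` intertwines it with `Z`, so compressing `cfc f X` by `V`
  -- gives exactly `cfc f Z`.
  set X : Matrix ι ι ℂ := V * Z * Vᴴ + s • (R * A * R) with hX
  have hXV : X * V = V * Z := by
    rw [hX, Matrix.add_mul, Matrix.mul_assoc, hV, Matrix.smul_mul, Matrix.mul_assoc _ R, hRV]
    simp
  have hAX : A ≤ X := by
    have h1 : V * (r • (Vᴴ * A * V)) * Vᴴ ≤ V * Z * Vᴴ := by
      simpa using conjTranspose_mul_mul_mono hZ Vᴴ
    have h2 : 0 ≤ (c • (V * Vᴴ) - c⁻¹ • R)ᴴ * A * (c • (V * Vᴴ) - c⁻¹ • R) :=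
      conjTranspose_mul_mul_nonneg hA _
    have h3 : (c • (V * Vᴴ) - c⁻¹ • R)ᴴ = c • (V * Vᴴ) - c⁻¹ • R := by
      simp [hRH]
    obtain ⟨P, hP⟩ : ∃ P, P = V * Vᴴ := ⟨_, rfl⟩
    have h4 : V * (r • (Vᴴ * A * V)) * Vᴴ = r • (P * A * P) := by
      rw [hP]; simp only [Matrix.mul_smul, Matrix.smul_mul, Matrix.mul_assoc]
    have h5 : A = P * A * P + P * A * R + R * A * P + R * A * R := by
      rw [hR, ← hP]; noncomm_ring
    have h6 : (c • P - c⁻¹ • R) * A * (c • P - c⁻¹ • R) =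
        (c ^ 2) • (P * A * P) - P * A * R - R * A * P + (c⁻¹ ^ 2) • (R * A * R) := by
      simp only [Matrix.mul_sub, Matrix.sub_mul, Matrix.mul_smul, Matrix.smul_mul]
      match_scalars <;> field_simp
    rw [h3, ← hP, h6] at h2
    rw [h4] at h1
    have h7 : r • (P * A * P) + s • (R * A * R) ≤ X := by
      rw [hX]; gcongr
    refine le_trans ?_ h7
    rw [← sub_nonneg]
    refine h2.trans_eq ?_
    rw [eq_sub_iff_add_eq, hcr, hs]
    refine (congrArg _ h5).trans ?_
    match_scalars <;> ring
  have hX0 := hA.trans hAX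
  have := conjTranspose_mul_mul_mono (hf.cfc_le_cfc hA hAX) V
  rwa [Matrix.mul_assoc _ (cfc f X), cfc_mul_eq_mul_cfc (nonneg_iff_posSemidef.1 hX0).1
    (nonneg_iff_posSemidef.1 hZ0).1 hXV, ← Matrix.mul_assoc, hV, Matrix.one_mul] at this

/-- **Hansen's inequality** for contractions `K`, in a form that needs no continuity of `f`. -/
theorem OMPlusOne.conjTranspose_mul_mul_le_cfc {f : ℝ → ℝ} (hf : OMPlusOne f) {K : Matrix ι κ ℂ}
    (hK : Kᴴ * K ≤ 1) {b : ι → ℝ} (hb : ∀ i, 0 ≤ b i) {Z : Matrix κ κ ℂ} {r : ℝ} (hr : 1 < r)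
    (hZ : r • (Kᴴ * diagonal (fun i => (b i : ℂ)) * K) ≤ Z) :
    Kᴴ * diagonal (fun i => (f (b i) : ℂ)) * K ≤ cfc f Z := by
  set D := CFC.sqrt (1 - Kᴴ * K) with hD
  have hDD : D * D = 1 - Kᴴ * K := CFC.sqrt_mul_sqrt_self _ (sub_nonneg.2 hK)
  have hDH : Dᴴ = D := (CFC.sqrt_nonneg _).isSelfAdjoint
  -- Isometric dilation of `K`. Padding `b` with zeros adds only `f 0 • (D * D) ≥ 0`, which is
  -- discarded.
  set V : Matrix (ι ⊕ κ) κ ℂ := fromRows K D with hV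
  have hVH : Vᴴ = fromCols Kᴴ D := by
    rw [hV, conjTranspose_fromRows_eq_fromCols_conjTranspose, hDH]
  have hVV : Vᴴ * V = 1 := by
    rw [hVH, hV, fromCols_mul_fromRows, hDD]; abel
  have hbig : ∀ g : ℝ → ℝ, Vᴴ * diagonal (fun i => (g (Sum.elim b (0 : κ → ℝ) i) : ℂ)) * V =
      Kᴴ * diagonal (fun i => (g (b i) : ℂ)) * K + (g 0) • (D * D) := by
    intro g
    have : diagonal (fun i => (g (Sum.elim b (0 : κ → ℝ) i) : ℂ)) =
        fromBlocks (diagonal fun i => (g (b i) : ℂ)) 0 0 ((g 0) • 1) := by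
      ext (i | i) (j | j) <;> simp [diagonal_apply, one_apply]
    rw [this, hVH, fromCols_mul_fromBlocks, hV, fromCols_mul_fromRows]
    simp
  have := conjTranspose_mul_mul_le_cfc_of_isometry hf hVV
    (A := diagonal (fun i => ((Sum.elim b (0 : κ → ℝ) i : ℝ) : ℂ))) (Z := Z) (r := r) ?_ hr ?_
  · rw [cfc_diagonal_ofReal, hbig] at this
    refine le_trans (le_add_of_nonneg_right ?_) this
    apply smul_nonneg (hf.nonneg 0 le_rfl)
    rw [hDD]
    exact sub_nonneg.2 hK
  · rw [nonneg_iff_posSemidef, posSemidef_diagonal_iff]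
    rintro (i | i) <;> simp [hb]
  · rwa [hbig (fun x => x), zero_smul, add_zero]

theorem diagonal_ofReal_le_diagonal_ofReal {d e : ι → ℝ} :
    diagonal (fun i => (d i : ℂ)) ≤ diagonal (fun i => (e i : ℂ)) ↔ ∀ i, d i ≤ e i := by
  rw [Matrix.le_iff, diagonal_sub, posSemidef_diagonal_iff]
  simp [← Complex.ofReal_sub]

/-- For `T = K Kᴴ`, conjugating the hypothesis gives `T² ≤ T`, and `1 - T = (1 - T)² + (T - T²)`. -/
theorem mul_conjTranspose_le_one {K : Matrix ι κ ℂ} (hK : Kᴴ * K ≤ 1) : K * Kᴴ ≤ 1 := by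
  have h1 : K * Kᴴ * (K * Kᴴ) ≤ K * Kᴴ := by
    simpa [Matrix.mul_assoc] using conjTranspose_mul_mul_mono hK Kᴴ
  have h2 : 0 ≤ (1 - K * Kᴴ)ᴴ * (1 - K * Kᴴ) := conjTranspose_mul_self_nonneg _
  have h3 : (1 - K * Kᴴ)ᴴ = 1 - K * Kᴴ := by simp
  rw [h3] at h2
  have h4 : 1 - K * Kᴴ = (1 - K * Kᴴ) * (1 - K * Kᴴ) + (K * Kᴴ - K * Kᴴ * (K * Kᴴ)) := by
    noncomm_ring
  rw [← sub_nonneg, h4]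
  exact add_nonneg h2 (sub_nonneg.2 h1)

/-- The two sides are `Mᴴ M` and `M Mᴴ` for `M = Y^{1/2} Wᴴ`; the second depends on `W` only through
`Wᴴ W`. -/
theorem conj_le_one_iff_sqrt {W : Matrix κ ι ℂ} {Y : Matrix ι ι ℂ} (hY : 0 ≤ Y) :
    W * Y * Wᴴ ≤ 1 ↔ CFC.sqrt Y * (Wᴴ * W) * CFC.sqrt Y ≤ 1 := by
  have hSS : CFC.sqrt Y * CFC.sqrt Y = Y := CFC.sqrt_mul_sqrt_self _ hY
  have hSH : (CFC.sqrt Y)ᴴ = CFC.sqrt Y := (CFC.sqrt_nonneg _).isSelfAdjoint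
  set S := CFC.sqrt Y
  have e1 : W * Y * Wᴴ = (S * Wᴴ)ᴴ * (S * Wᴴ) := by
    rw [← hSS, conjTranspose_mul, hSH]; simp [Matrix.mul_assoc]
  have e2 : S * (Wᴴ * W) * S = (S * Wᴴ) * (S * Wᴴ)ᴴ := by
    rw [conjTranspose_mul, hSH]; simp [Matrix.mul_assoc]
  rw [e1, e2]
  exact ⟨mul_conjTranspose_le_one, fun h => by
    simpa using mul_conjTranspose_le_one (K := (S * Wᴴ)ᴴ) (by simpa using h)⟩

/-- The condition `X^{1/2} Y X^{1/2} ≤ 1` does not depend on the chosen square root of `X`. -/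
theorem sqrt_conj_le_one_iff {X : Matrix ι ι ℂ} {W : Matrix κ ι ℂ} (hW : Wᴴ * W = X)
    {Y : Matrix ι ι ℂ} (hY : 0 ≤ Y) : CFC.sqrt X * Y * CFC.sqrt X ≤ 1 ↔ W * Y * Wᴴ ≤ 1 := by
  have hX : 0 ≤ X := hW ▸ conjTranspose_mul_self_nonneg W
  have hSH : (CFC.sqrt X)ᴴ = CFC.sqrt X := (CFC.sqrt_nonneg _).isSelfAdjoint
  have h := conj_le_one_iff_sqrt (W := CFC.sqrt X) hY
  rw [hSH, CFC.sqrt_mul_sqrt_self X hX] at h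
  rw [h, conj_le_one_iff_sqrt hY, hW]

end
-- Scalar bounds and diagonal representation of positive maps
section
variable {ι κ : Type*} [Fintype ι] [DecidableEq ι] [Fintype κ] [DecidableEq κ]

theorem exists_le_smul_one {M : Matrix ι ι ℂ} (hM : M.IsHermitian) :
    ∃ c : ℝ, 0 ≤ c ∧ M ≤ c • (1 : Matrix ι ι ℂ) := by
  obtain ⟨U, d, -, hU', -, hf⟩ := exists_unitary_cfc_eq hM
  refine ⟨∑ i, |d i|, Finset.sum_nonneg fun i _ => abs_nonneg _, ?_⟩
  have h := conjTranspose_mul_mul_mono (diagonal_ofReal_le_diagonal_ofReal.2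
    fun i => (le_abs_self (d i)).trans
      (Finset.single_le_sum (f := fun i => |d i|) (fun i _ => abs_nonneg _) (Finset.mem_univ i))) Uᴴ
  rw [conjTranspose_conjTranspose, ← hf (fun x => x), cfc_id_matrix hM] at h
  refine h.trans_eq ?_
  have : diagonal (fun _ : ι => ((∑ i, |d i| : ℝ) : ℂ)) = (∑ i, |d i|) • (1 : Matrix ι ι ℂ) := by
    ext i j; simp [diagonal_apply, one_apply]
  rw [this, Matrix.mul_smul, Matrix.smul_mul, Matrix.mul_one, hU']

theorem le_one_of_forall_le_smul_one {M : Matrix ι ι ℂ} (hM : M.IsHermitian)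
    (h : ∀ r : ℝ, 1 < r → M ≤ r • (1 : Matrix ι ι ℂ)) : M ≤ 1 := by
  obtain ⟨U, d, hU, hU', -, hf⟩ := exists_unitary_cfc_eq hM
  have hMd : M = U * diagonal (fun i => (d i : ℂ)) * Uᴴ := by
    rw [← hf (fun x => x), cfc_id_matrix hM]
  have hd : ∀ i, d i ≤ 1 := fun i => le_of_forall_gt_imp_ge_of_dense fun r hr => by
    have h1 := conjTranspose_mul_mul_mono (h r hr) U
    have h2 : Uᴴ * M * U = diagonal (fun i => (d i : ℂ)) := by
      calc _ = (Uᴴ * U) * diagonal (fun i => (d i : ℂ)) * (Uᴴ * U) := by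
            rw [hMd]; simp only [Matrix.mul_assoc]
        _ = _ := by rw [hU, Matrix.one_mul, Matrix.mul_one]
    have h3 : Uᴴ * r • (1 : Matrix ι ι ℂ) * U = diagonal (fun _ => (r : ℂ)) := by
      rw [Matrix.mul_smul, Matrix.smul_mul, Matrix.mul_one, hU]
      ext i j; simp [diagonal_apply, one_apply]
    rw [h2, h3] at h1
    exact diagonal_ofReal_le_diagonal_ofReal.1 h1 i
  have h1 := conjTranspose_mul_mul_mono (diagonal_ofReal_le_diagonal_ofReal.2 hd) Uᴴ
  rw [conjTranspose_conjTranspose, ← hMd] at h1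
  simpa [hU'] using h1

/-- A positive linear map restricted to the functional calculus of a Hermitian matrix is a
compression of a diagonal representation. -/
theorem exists_map_cfc_eq {A : Matrix ι ι ℂ} (hA : A.IsHermitian)
    (Φ : Matrix ι ι ℂ →ₚ[ℂ] Matrix κ κ ℂ) :
    ∃ (W : Matrix (ι × κ) κ ℂ) (a : ι → ℝ), (∀ i, a i ∈ spectrum ℝ A) ∧
      ∀ g : ℝ → ℝ, Φ (cfc g A) = Wᴴ * diagonal (fun p : ι × κ => (g (a p.1) : ℂ)) * W := by
  obtain ⟨U, a, -, -, ha, hf⟩ := exists_unitary_cfc_eq hA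
  let P : ι → Matrix ι ι ℂ := fun i => U * diagonal (Pi.single i 1) * Uᴴ
  have hP : ∀ i, 0 ≤ Φ (P i) := by
    intro i
    have h1 : (0 : Matrix ι ι ℂ) ≤ diagonal (Pi.single i 1) := by
      rw [nonneg_iff_posSemidef, posSemidef_diagonal_iff]
      intro j
      by_cases hj : j = i
      · subst hj; simp
      · simp [hj]
    have h2 := conjTranspose_mul_mul_nonneg h1 Uᴴ
    rw [conjTranspose_conjTranspose] at h2
    simpa using OrderHomClass.mono Φ h2
  let S : ι → Matrix κ κ ℂ := fun i => CFC.sqrt (Φ (P i))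
  have hSS : ∀ i, (S i)ᴴ * S i = Φ (P i) := by
    intro i
    have : (S i)ᴴ = S i := (CFC.sqrt_nonneg _).isSelfAdjoint
    rw [this]
    exact CFC.sqrt_mul_sqrt_self _ (hP i)
  -- `W` stacks the square roots of `Φ (P i)`, with `P i` the rank-one spectral projections;
  -- positivity of `Φ` on these suffices.
  refine ⟨of fun p y => S p.1 p.2 y, a, ha, fun g => ?_⟩
  have h1 : cfc g A = ∑ i, (g (a i) : ℂ) • P i := by
    have : diagonal (fun i => (g (a i) : ℂ)) =
        ∑ i, (g (a i) : ℂ) • diagonal (Pi.single i (1 : ℂ)) := by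
      ext j k
      simp [Matrix.sum_apply, diagonal_apply, Pi.single_apply]
    rw [hf, this, Matrix.mul_sum, Matrix.sum_mul]
    simp [P]
  rw [h1, map_sum]
  ext x y
  rw [Matrix.sum_apply, Matrix.mul_assoc, Matrix.mul_apply, Fintype.sum_prod_type]
  refine Finset.sum_congr rfl fun i _ => ?_
  rw [map_smul, ← hSS, Matrix.smul_apply, Matrix.mul_apply, Finset.smul_sum]
  refine Finset.sum_congr rfl fun k _ => ?_
  rw [diagonal_mul]
  simp only [conjTranspose_apply, of_apply, smul_eq_mul]
  ring

end

/-! ### Scalar estimates for `f` and `f*` -/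

/-- Hansen's inequality in dimension one, for the contraction `K = (t r)^{-1/2}`. -/
theorem OMPlusOne.map_mul_le {f : ℝ → ℝ} (hf : OMPlusOne f) {t r x : ℝ} (ht : 1 ≤ t) (hr : 1 < r)
    (hx : 0 ≤ x) : f (t * x) ≤ t * r * f x := by
  have hs : 0 < t * r := by positivity
  set c : ℝ := √(t * r)⁻¹
  have hc : (c : ℂ) * c = ((t * r)⁻¹ : ℝ) := by
    rw [← Complex.ofReal_mul, Real.mul_self_sqrt (by positivity)]
  have hKH : (diagonal fun _ : Unit => (c : ℂ))ᴴ = diagonal fun _ : Unit => (c : ℂ) :=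
    isHermitian_diagonal_ofReal _
  have hcomp : ∀ d : Unit → ℝ, (diagonal fun _ : Unit => (c : ℂ))ᴴ * diagonal (fun i => (d i : ℂ)) *
      (diagonal fun _ : Unit => (c : ℂ)) = diagonal fun i => (((t * r)⁻¹ * d i : ℝ) : ℂ) := by
    intro d
    rw [hKH, diagonal_mul_diagonal, diagonal_mul_diagonal]
    congr 1; ext i
    rw [mul_right_comm, hc, ← Complex.ofReal_mul]
  have := hf.conjTranspose_mul_mul_le_cfc (K := diagonal fun _ : Unit => (c : ℂ))
    (b := fun _ => t * x) (Z := diagonal fun _ => (x : ℂ)) (r := r) ?_ (fun _ => by positivity)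
    hr ?_
  · rw [hcomp (fun _ => f (t * x)), cfc_diagonal_ofReal f (fun _ => x),
      diagonal_ofReal_le_diagonal_ofReal] at this
    have := this ()
    rwa [inv_mul_le_iff₀ hs] at this
  · have h1 := hcomp (fun _ => 1)
    have h2 : (diagonal (fun _ => ((1 : ℝ) : ℂ)) : Matrix Unit Unit ℂ) = 1 := by simp
    rw [h2, Matrix.mul_one] at h1
    rw [h1, ← h2, diagonal_ofReal_le_diagonal_ofReal]
    intro i
    rw [mul_one]
    exact inv_le_one_of_one_le₀ (one_le_mul_of_one_le_of_one_le ht hr.le)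
  · rw [hcomp (fun _ => t * x)]
    apply le_of_eq
    ext i j
    simp only [Matrix.smul_apply, diagonal_apply, if_true, Complex.real_smul,
      ← Complex.ofReal_mul]
    congr 1
    field_simp

theorem OMPlusOne.pos {f : ℝ → ℝ} (hf : OMPlusOne f) {x : ℝ} (hx : 0 < x) : 0 < f x := by
  rcases le_total 1 x with h | h
  · have := hf.monotoneOn (by simp) (by simpa using hx.le) h
    rw [hf.map_one] at this
    linarith
  · have h1 := hf.map_mul_le ((one_le_inv₀ hx).2 h) one_lt_two hx.le
    rw [inv_mul_cancel₀ hx.ne', hf.map_one] at h1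
    exact pos_of_mul_pos_right (zero_lt_one.trans_le h1) (by positivity)

theorem OMPlusOne.adjointFun_nonneg {f : ℝ → ℝ} (hf : OMPlusOne f) {x : ℝ} (hx : 0 ≤ x) :
    0 ≤ adjointFun f x := by
  have key : ∀ t : ℝ, 0 < t → 0 ≤ adjointFun f t := fun t ht => by
    rw [adjointFun, if_pos ht]
    exact inv_nonneg.2 (hf.nonneg _ (inv_nonneg.2 ht.le))
  rcases hx.eq_or_lt with rfl | hx
  · exact ge_of_tendsto hf.tendsto_adjointFun
      (by filter_upwards [self_mem_nhdsWithin] with t ht using key t ht)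
  · exact key x hx

/-- Strictness makes `y > 0`, where the explicit formula applies; `x = 0` follows by passing to the
limit. -/
theorem OMPlusOne.adjointFun_mono {f : ℝ → ℝ} (hf : OMPlusOne f) {x y : ℝ} (hx : 0 ≤ x)
    (hxy : x < y) : adjointFun f x ≤ adjointFun f y := by
  have key : ∀ t : ℝ, 0 < t → t < y → adjointFun f t ≤ adjointFun f y := fun t ht hty => by
    have hy := ht.trans hty
    rw [adjointFun, if_pos ht, adjointFun, if_pos hy]
    exact inv_anti₀ (hf.pos (inv_pos.2 hy)) (hf.monotoneOn (inv_nonneg.2 hy.le)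
      (inv_nonneg.2 ht.le) (inv_anti₀ ht hty.le))
  rcases hx.eq_or_lt with rfl | hx
  · exact le_of_tendsto hf.tendsto_adjointFun
      (by filter_upwards [Ioo_mem_nhdsGT hxy] with t ht using key t ht.1 ht.2)
  · exact key x hx hxy

/-! ### The inequality for diagonal matrices, and reduction to it -/

section
variable {ι κ : Type*} [Fintype ι] [DecidableEq ι] [Fintype κ] [DecidableEq κ]

/-- The inequality of the main theorem for a contraction between diagonal matrices. -/
theorem OMPlusOne.diagonal_conj_le_one {f : ℝ → ℝ} (hf : OMPlusOne f) {K : Matrix ι κ ℂ}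
    (hK : Kᴴ * K ≤ 1) {a : κ → ℝ} {b : ι → ℝ} (ha : ∀ i, 0 ≤ a i) (hb : ∀ i, 0 ≤ b i)
    (h : diagonal (fun i => (√(a i) : ℂ)) * (Kᴴ * diagonal (fun i => (b i : ℂ)) * K) *
      diagonal (fun i => (√(a i) : ℂ)) ≤ 1) :
    diagonal (fun i => (√(adjointFun f (a i)) : ℂ)) *
      (Kᴴ * diagonal (fun i => (f (b i) : ℂ)) * K) *
      diagonal (fun i => (√(adjointFun f (a i)) : ℂ)) ≤ 1 := by
  have hconj : ∀ (d e : κ → ℝ), (∀ i, 0 ≤ d i) →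
      diagonal (fun i => (√(d i) : ℂ)) * diagonal (fun i => (e i : ℂ)) *
        diagonal (fun i => (√(d i) : ℂ)) = diagonal (fun i => ((d i * e i : ℝ) : ℂ)) := by
    intro d e hd
    rw [diagonal_mul_diagonal, diagonal_mul_diagonal]
    congr 1; ext i
    rw [mul_right_comm, ← Complex.ofReal_mul, Real.mul_self_sqrt (hd i), ← Complex.ofReal_mul]
  have hone : diagonal (fun _ : κ => ((1 : ℝ) : ℂ)) = 1 := by simp
  have hH : ∀ d : κ → ℝ, (diagonal (fun i => (√(d i) : ℂ)))ᴴ = diagonal (fun i => (√(d i) : ℂ)) :=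
    fun d => isHermitian_diagonal_ofReal _
  have hsq : ∀ d : κ → ℝ, (∀ i, 0 ≤ d i) →
      (diagonal (fun i => (√(d i) : ℂ)))ᴴ * diagonal (fun i => (√(d i) : ℂ)) =
        diagonal (fun i => (d i : ℂ)) := by
    intro d hd
    have := hconj d (fun _ => 1) hd
    rw [hone, Matrix.mul_one] at this
    rw [hH, this]; simp
  have hdiag0 : ∀ d : ι → ℝ, (∀ i, 0 ≤ d i) → 0 ≤ diagonal (fun i => (d i : ℂ)) := by
    intro d hd
    rw [nonneg_iff_posSemidef, posSemidef_diagonal_iff]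
    simpa using hd
  set C := Kᴴ * diagonal (fun i => (b i : ℂ)) * K with hC
  have hC0 : 0 ≤ C := conjTranspose_mul_mul_nonneg (hdiag0 b hb) K
  set S := CFC.sqrt C
  have hSS : S * S = C := CFC.sqrt_mul_sqrt_self C hC0
  obtain ⟨c, hc0, hc⟩ := exists_le_smul_one (nonneg_iff_posSemidef.1 hC0).1
  have hS : S * diagonal (fun i => (a i : ℂ)) * S ≤ 1 := by
    rw [← hsq a ha]
    exact (conj_le_one_iff_sqrt hC0).1 (by rwa [hH])
  have hmain0 : 0 ≤ diagonal (fun i => (√(adjointFun f (a i)) : ℂ)) *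
      (Kᴴ * diagonal (fun i => (f (b i) : ℂ)) * K) *
      diagonal (fun i => (√(adjointFun f (a i)) : ℂ)) := by
    have := conjTranspose_mul_mul_nonneg (conjTranspose_mul_mul_nonneg
      (hdiag0 (fun i => f (b i)) fun i => hf.nonneg _ (hb i)) K)
      (diagonal (fun i => (√(adjointFun f (a i)) : ℂ)))
    rwa [hH (fun i => adjointFun f (a i))] at this
  apply le_one_of_forall_le_smul_one (nonneg_iff_posSemidef.1 hmain0).1
  -- It suffices to bound by `r ^ 3` for every `r > 1`.
  suffices H : ∀ r : ℝ, 1 < r → diagonal (fun i => (√(adjointFun f (a i)) : ℂ)) *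
      (Kᴴ * diagonal (fun i => (f (b i) : ℂ)) * K) *
      diagonal (fun i => (√(adjointFun f (a i)) : ℂ)) ≤ (r ^ 3) • (1 : Matrix κ κ ℂ) by
    intro r hr
    have h3 : (r ^ (3 : ℝ)⁻¹) ^ 3 = r := by
      rw [← Real.rpow_natCast, ← Real.rpow_mul (by linarith)]; norm_num
    have := H (r ^ (3 : ℝ)⁻¹) (Real.one_lt_rpow hr (by norm_num))
    rwa [h3] at this
  intro r hr
  have hr0 : 0 < r := by linarith
  -- `D_a + ε` is invertible, and `S (D_a + ε) S = S D_a S + ε C ≤ 1 + ε c ≤ r`.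
  obtain ⟨ε, hε, hεc⟩ : ∃ ε : ℝ, 0 < ε ∧ 1 + ε * c ≤ r := by
    refine ⟨(r - 1) / (c + 1), div_pos (by linarith) (by linarith), ?_⟩
    have : (r - 1) / (c + 1) * (c + 1) = r - 1 := div_mul_cancel₀ _ (by linarith)
    have : 0 < (r - 1) / (c + 1) := div_pos (by linarith) (by linarith)
    linarith
  have ha' : ∀ i, 0 < a i + ε := fun i => by linarith [ha i]
  -- The perturbed condition `C ≤ r (D_a + ε)⁻¹`.
  have hSr : S * diagonal (fun i => (((a i + ε) / r : ℝ) : ℂ)) * S ≤ 1 := by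
    have e1 : diagonal (fun i => (((a i + ε) / r : ℝ) : ℂ)) =
        r⁻¹ • (diagonal (fun i => (a i : ℂ)) + ε • (1 : Matrix κ κ ℂ)) := by
      ext i j
      by_cases hij : i = j
      · subst hij; simp; ring
      · simp [hij]
    have e2 : S * diagonal (fun i => (a i : ℂ)) * S + ε • C ≤ r • (1 : Matrix κ κ ℂ) := by
      calc _ ≤ (1 : Matrix κ κ ℂ) + ε • (c • (1 : Matrix κ κ ℂ)) :=
            add_le_add hS (smul_le_smul_of_nonneg_left hc hε.le)
        _ = (1 + ε * c) • (1 : Matrix κ κ ℂ) := by rw [smul_smul, add_smul, one_smul]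
        _ ≤ _ := smul_le_smul_of_nonneg_right hεc (nonneg_iff_posSemidef.2 PosSemidef.one)
    have e3 := smul_le_smul_of_nonneg_left e2 (inv_nonneg.2 hr0.le)
    rw [smul_smul, inv_mul_cancel₀ hr0.ne', one_smul] at e3
    refine le_trans (le_of_eq ?_) e3
    rw [e1, Matrix.mul_smul, Matrix.smul_mul, Matrix.mul_add, Matrix.add_mul, Matrix.mul_smul,
      Matrix.mul_one, Matrix.smul_mul, hSS]
  have hCr : C ≤ diagonal (fun i => ((r / (a i + ε) : ℝ) : ℂ)) := by
    have hq : ∀ i, 0 < (a i + ε) / r := fun i => div_pos (ha' i) hr0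
    rw [← hsq (fun i => (a i + ε) / r) fun i => (hq i).le] at hSr
    have h1 := (conj_le_one_iff_sqrt hC0).2 hSr
    rw [hH (fun i => (a i + ε) / r)] at h1
    have h2 := conjTranspose_mul_mul_mono h1
      (diagonal (fun i => (√(r / (a i + ε)) : ℂ)))
    rw [Matrix.mul_one, hsq (fun i => r / (a i + ε)) (fun i => (div_pos hr0 (ha' i)).le),
      hH (fun i => r / (a i + ε))] at h2
    have h3 : ∀ i, (√(r / (a i + ε)) : ℂ) * √((a i + ε) / r) = 1 := by
      intro i
      rw [← Complex.ofReal_mul, ← Real.sqrt_mul (div_pos hr0 (ha' i)).le, div_mul_div_comm,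
        mul_comm r, div_self (mul_pos (ha' i) hr0).ne']
      simp
    have h4 : diagonal (fun i => (√(r / (a i + ε)) : ℂ)) *
        diagonal (fun i => (√((a i + ε) / r) : ℂ)) = 1 := by
      rw [diagonal_mul_diagonal]; simp [h3]
    have h5 : diagonal (fun i => (√((a i + ε) / r) : ℂ)) *
        diagonal (fun i => (√(r / (a i + ε)) : ℂ)) = 1 := mul_eq_one_comm.1 h4
    rwa [Matrix.mul_assoc, Matrix.mul_assoc, Matrix.mul_assoc, h5, Matrix.mul_one,
      ← Matrix.mul_assoc, h4, Matrix.one_mul] at h2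
  have hZ : r • C ≤ diagonal (fun i => ((r * (r * (a i + ε)⁻¹) : ℝ) : ℂ)) := by
    refine (smul_le_smul_of_nonneg_left hCr hr0.le).trans_eq ?_
    ext i j
    simp [diagonal_apply, div_eq_mul_inv]
  have hF := hf.conjTranspose_mul_mul_le_cfc hK hb hr hZ
  rw [cfc_diagonal_ofReal] at hF
  have hG := conjTranspose_mul_mul_mono hF (diagonal (fun i => (√(adjointFun f (a i)) : ℂ)))
  rw [hH (fun i => adjointFun f (a i)), hconj (fun i => adjointFun f (a i)) _
    fun i => hf.adjointFun_nonneg (ha i)] at hG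
  refine hG.trans ?_
  have e : (r ^ 3) • (1 : Matrix κ κ ℂ) = diagonal (fun _ => ((r ^ 3 : ℝ) : ℂ)) := by
    ext i j; simp [diagonal_apply, one_apply]
  rw [e, diagonal_ofReal_le_diagonal_ofReal]
  intro i
  have hpos : 0 < (a i + ε)⁻¹ := inv_pos.2 (ha' i)
  have hfp := hf.pos hpos
  -- `r ^ 2` collects the perturbation and the slack in Hansen's inequality; the third `r` is the
  -- slack of `map_mul_le`.
  have h1 := hf.map_mul_le (t := r ^ 2) (one_le_pow₀ hr.le) hr hpos.le
  have h2 := hf.adjointFun_mono (ha i) (lt_add_of_pos_right (a i) hε)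
  rw [adjointFun, adjointFun, if_pos (ha' i), ← adjointFun] at h2
  calc adjointFun f (a i) * f (r * (r * (a i + ε)⁻¹))
      ≤ (f (a i + ε)⁻¹)⁻¹ * (r ^ 3 * f (a i + ε)⁻¹) := by
        refine mul_le_mul h2 ?_ (hf.nonneg _ (by positivity)) (inv_nonneg.2 hfp.le)
        rwa [← mul_assoc, ← pow_two, pow_succ]
    _ = r ^ 3 := by rw [mul_left_comm, inv_mul_cancel₀ hfp.ne', mul_one]

theorem spectrum_nonneg_of_nonneg {A : Matrix ι ι ℂ} (hA : 0 ≤ A) {x : ℝ} (hx : x ∈ spectrum ℝ A) :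
    0 ≤ x := by
  have h := nonneg_iff_posSemidef.1 hA
  rw [h.1.spectrum_real_eq_range_eigenvalues] at hx
  obtain ⟨i, rfl⟩ := hx
  exact h.eigenvalues_nonneg i

theorem sqrt_map_adjointFun_conj_le_one {μ : Type*} [Fintype μ] [DecidableEq μ]
    (Φ : Matrix ι ι ℂ →ₚ[ℂ] Matrix μ μ ℂ) (Ψ : Matrix κ κ ℂ →ₚ[ℂ] Matrix μ μ ℂ)
    (hI : CFC.sqrt (Φ 1) * Ψ 1 * CFC.sqrt (Φ 1) ≤ 1) {A : Matrix ι ι ℂ} {B : Matrix κ κ ℂ}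
    (hA : 0 ≤ A) (hB : 0 ≤ B) (hAB : CFC.sqrt (Φ A) * Ψ B * CFC.sqrt (Φ A) ≤ 1)
    {f : ℝ → ℝ} (hf : OMPlusOne f) :
    CFC.sqrt (Φ (cfc (adjointFun f) A)) * Ψ (cfc f B) * CFC.sqrt (Φ (cfc (adjointFun f) A)) ≤
      1 := by
  have hAh := (nonneg_iff_posSemidef.1 hA).1
  have hBh := (nonneg_iff_posSemidef.1 hB).1
  obtain ⟨W, a, ha, hW⟩ := exists_map_cfc_eq hAh Φ
  obtain ⟨V, b, hb, hV⟩ := exists_map_cfc_eq hBh Ψ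
  have ha0 : ∀ i, 0 ≤ a i := fun i => spectrum_nonneg_of_nonneg hA (ha i)
  have hb0 : ∀ i, 0 ≤ b i := fun i => spectrum_nonneg_of_nonneg hB (hb i)
  -- Applied to the pairs `(f*, f)`, `(1, 1)` and `(id, id)`: the goal, the contractivity of `V *
  -- Wᴴ`, and the hypothesis on `A` and `B`.
  have key : ∀ g h : ℝ → ℝ, (∀ x, 0 ≤ x → 0 ≤ g x) → (∀ x, 0 ≤ x → 0 ≤ h x) →
      (CFC.sqrt (Φ (cfc g A)) * Ψ (cfc h B) * CFC.sqrt (Φ (cfc g A)) ≤ 1 ↔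
        diagonal (fun p : ι × μ => (√(g (a p.1)) : ℂ)) *
          ((V * Wᴴ)ᴴ * diagonal (fun p : κ × μ => (h (b p.1) : ℂ)) * (V * Wᴴ)) *
          diagonal (fun p : ι × μ => (√(g (a p.1)) : ℂ)) ≤ 1) := by
    intro g h hg hh
    have hT : (diagonal (fun p : ι × μ => (√(g (a p.1)) : ℂ)))ᴴ =
        diagonal (fun p : ι × μ => (√(g (a p.1)) : ℂ)) := isHermitian_diagonal_ofReal _
    rw [hW, hV, sqrt_conj_le_one_iff (W := diagonal (fun p : ι × μ => (√(g (a p.1)) : ℂ)) * W)]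
    · rw [conjTranspose_mul, hT, conjTranspose_mul, conjTranspose_conjTranspose]
      simp only [Matrix.mul_assoc]
    · rw [conjTranspose_mul, hT, Matrix.mul_assoc, ← Matrix.mul_assoc _ _ W,
        diagonal_mul_diagonal, Matrix.mul_assoc]
      congr 3
      ext p
      rw [← Complex.ofReal_mul, Real.mul_self_sqrt (hg _ (ha0 _))]
    · refine conjTranspose_mul_mul_nonneg ?_ V
      rw [nonneg_iff_posSemidef, posSemidef_diagonal_iff]
      intro p
      simpa using hh _ (hb0 p.1)
  rw [key _ _ (fun x hx => hf.adjointFun_nonneg hx) hf.nonneg]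
  refine hf.diagonal_conj_le_one ?_ (fun p => ha0 p.1) (fun p => hb0 p.1) ?_
  · have := key (fun _ => 1) (fun _ => 1) (by simp) (by simp)
    rw [cfc_const_one ℝ A, cfc_const_one ℝ B] at this
    simpa using this.1 hI
  · have := key (fun x => x) (fun x => x) (by simp) (by simp)
    rw [cfc_id_matrix hAh, cfc_id_matrix hBh] at this
    exact this.1 hAB

end

/-! ### Power functions -/

open scoped Matrix.Norms.L2Operator in
theorem omPlusOne_rpow {α : ℝ} (h0 : 0 ≤ α) (h1 : α ≤ 1) : OMPlusOne (fun x : ℝ => x ^ α) where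
  nonneg _ hx := Real.rpow_nonneg hx _
  map_one := Real.one_rpow _
  operator_mono k A B hA hAB := by
    rw [← CFC.rpow_eq_cfc_real hA, ← CFC.rpow_eq_cfc_real (hA.trans hAB)]
    exact CFC.rpow_le_rpow ⟨h0, h1⟩ hAB

/-- At `0` both sides are the limit of `t ^ α`; for `α = 0` this is `1`, in agreement with `0 ^ 0 =
1`. -/
theorem adjointFun_rpow {α x : ℝ} (h0 : 0 ≤ α) (h1 : α ≤ 1) (hx : 0 ≤ x) :
    adjointFun (fun x : ℝ => x ^ α) x = x ^ α := by
  have key : ∀ t : ℝ, 0 < t → adjointFun (fun x : ℝ => x ^ α) t = t ^ α := fun t ht => by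
    rw [adjointFun, if_pos ht, Real.inv_rpow ht.le, inv_inv]
  rcases hx.eq_or_lt with rfl | hx
  · refine tendsto_nhds_unique (omPlusOne_rpow h0 h1).tendsto_adjointFun ?_
    have : Filter.Tendsto (fun t : ℝ => t ^ α) (𝓝[>] 0) (𝓝 (0 ^ α)) :=
      (Real.continuous_rpow_const h0).continuousWithinAt
    refine this.congr' ?_
    filter_upwards [self_mem_nhdsWithin] with t ht using (key t ht).symm
  · exact key x hx

end MatrixMeans

theorem corollary2p3 {n m l : ℕ}
    (Φ : Matrix (Fin n) (Fin n) ℂ →ₚ[ℂ] Matrix (Fin l) (Fin l) ℂ)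
    (Ψ : Matrix (Fin m) (Fin m) ℂ →ₚ[ℂ] Matrix (Fin l) (Fin l) ℂ)
    (hI : CFC.sqrt (Φ 1) * Ψ 1 * CFC.sqrt (Φ 1) ≤ 1)
    (A : Matrix (Fin n) (Fin n) ℂ) (B : Matrix (Fin m) (Fin m) ℂ)
    (hA : 0 ≤ A) (hB : 0 ≤ B)
    (hAB : CFC.sqrt (Φ A) * Ψ B * CFC.sqrt (Φ A) ≤ 1) :
    (∀ f : ℝ → ℝ, MatrixMeans.OMPlusOne f →
      CFC.sqrt (Φ (cfc (MatrixMeans.adjointFun f) A)) * Ψ (cfc f B) *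
        CFC.sqrt (Φ (cfc (MatrixMeans.adjointFun f) A)) ≤ 1) ∧
    (∀ α : ℝ, 0 ≤ α → α ≤ 1 →
      CFC.sqrt (Φ (A ^ α)) * Ψ (B ^ α) * CFC.sqrt (Φ (A ^ α)) ≤ 1) := by
  have main := fun (f : ℝ → ℝ) (hf : MatrixMeans.OMPlusOne f) =>
    MatrixMeans.sqrt_map_adjointFun_conj_le_one Φ Ψ hI hA hB hAB hf
  refine ⟨main, fun α h0 h1 => ?_⟩
  have h := main _ (MatrixMeans.omPlusOne_rpow h0 h1)
  rwa [cfc_congr (g := fun x : ℝ => x ^ α) (fun x hx => MatrixMeans.adjointFun_rpow h0 h1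
    (MatrixMeans.spectrum_nonneg_of_nonneg hA hx)), ← CFC.rpow_eq_cfc_real hA,
    ← CFC.rpow_eq_cfc_real hB] at h
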